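/- Let $n\ge 1$, let $z=(z_1,\dots,z_n)$ and $D_i=\partial/\partial z_i$, let $A=(a_{ij})$ be a symmetric invertible complex $n\times n$ matrix, and put $\Delta_A=\sum_{i,j}a_{ij}D_iD_j$. Let $P\in\mathbb C[[z]]$ (for example a polynomial) be a formal power series all of whose terms have degree at least $2$, and assume that $P$ is $\Delta_A$-nilpotent, i.e. $\Delta_A^m(P^m)=0$ for all $m\ge 1$. Let $t$ be a formal parameter and $F_{A,t}(z)=z-tA\nabla P(z)$. Then there is a unique $Q_{A,t}(z)\in\mathbb C[t][[z]]$ with $Q_{A,t}(0)=0$ such that the formal inverse map of $F_{A,t}$ is $z+tA\nabla Q_{A,t}(z)$, and the following hold. (a) $Q_{A,t}$ is the unique solution, among all formal power series in $z$ and $t$, of the Cauchy problem $$\frac{\partial Q}{\partial t}=\frac14\,\Delta_A(Q^2),\qquad Q|_{t=0}=P .$$ (b) For every $k\ge 1$, as formal power series in $z$ and $t$, $$Q_{A,t}^k=\sum_{m\ge 0}\frac{k!\;t^m}{2^m\,m!\,(m+k)!}\,\Delta_A^m\bigl(P^{m+k}\bigr).$$ -/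

import Mathlib

open scoped Polynomial PowerSeries Nat

noncomputable section

namespace LaplaceInversion

/-- The operator `Δ_A = ∑ i j, a_ij D_i D_j` on formal power series in `z_1, …, z_n` over a
commutative `ℂ`-algebra `R` of constants (`R = ℂ`, or `R = ℂ⟦t⟧`, so that `t` is a parameter). -/
def lap {n : ℕ} {R : Type*} [CommRing R] [Algebra ℂ R] (A : Matrix (Fin n) (Fin n) ℂ)
    (f : MvPowerSeries (Fin n) R) : MvPowerSeries (Fin n) R :=
  ∑ i, ∑ j, A i j • MvPowerSeries.pderiv R i (MvPowerSeries.pderiv R j f)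

/-- `P` is `Δ_A`-nilpotent: `Δ_A ^ m (P ^ m) = 0` for all `m ≥ 1`. -/
def IsLapNilpotent {n : ℕ} (A : Matrix (Fin n) (Fin n) ℂ) (P : MvPowerSeries (Fin n) ℂ) : Prop :=
  ∀ m : ℕ, 1 ≤ m → (lap A)^[m] (P ^ m) = 0

/-- The `i`-th component of `A ∇f`. -/
def mulGrad {n : ℕ} {R : Type*} [CommRing R] [Algebra ℂ R] (A : Matrix (Fin n) (Fin n) ℂ)
    (f : MvPowerSeries (Fin n) R) (i : Fin n) : MvPowerSeries (Fin n) R :=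
  ∑ j, A i j • MvPowerSeries.pderiv R j f

/-- The formal map `F_{A,t}(z) = z - t A ∇P(z)`, with components in `ℂ[t][[z]]`; the polynomial
variable is `t`. -/
def mapF {n : ℕ} (A : Matrix (Fin n) (Fin n) ℂ) (P : MvPowerSeries (Fin n) ℂ) (i : Fin n) :
    MvPowerSeries (Fin n) ℂ[X] :=
  MvPowerSeries.X i -
    (Polynomial.X : ℂ[X]) • mulGrad A (MvPowerSeries.map (algebraMap ℂ ℂ[X]) P) i

/-- The formal map `z + t A ∇Q(z)`, for `Q ∈ ℂ[t][[z]]`. -/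
def mapG {n : ℕ} (A : Matrix (Fin n) (Fin n) ℂ) (Q : MvPowerSeries (Fin n) ℂ[X]) (i : Fin n) :
    MvPowerSeries (Fin n) ℂ[X] :=
  MvPowerSeries.X i + (Polynomial.X : ℂ[X]) • mulGrad A Q i

/-- `F` and `G` are formal maps that fix the origin and are inverse to each other under
composition: `F (G z) = z` and `G (F z) = z`. -/
def AreFormalInverse {n : ℕ} {R : Type*} [CommRing R]
    (F G : Fin n → MvPowerSeries (Fin n) R) : Prop :=
  (∀ i, MvPowerSeries.constantCoeff (F i) = 0) ∧
  (∀ i, MvPowerSeries.constantCoeff (G i) = 0) ∧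
  (∀ i, MvPowerSeries.subst G (F i) = MvPowerSeries.X i) ∧
  (∀ i, MvPowerSeries.subst F (G i) = MvPowerSeries.X i)

/-- `Q ∈ ℂ[t][[z]]` is a potential of the formal inverse of `F_{A,t}`: that inverse is
`z + t A ∇Q`. Only `∇Q` enters there, and `Q` is normalized by `Q(0) = 0`. -/
def IsInversionPotential {n : ℕ} (A : Matrix (Fin n) (Fin n) ℂ) (P : MvPowerSeries (Fin n) ℂ)
    (Q : MvPowerSeries (Fin n) ℂ[X]) : Prop :=
  MvPowerSeries.constantCoeff Q = 0 ∧ AreFormalInverse (mapF A P) (mapG A Q)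

/-- The inclusion of `ℂ[t][[z]]` in the ring `ℂ⟦t⟧[[z]]` of all formal power series in `z` and
`t`. -/
def toSeries {n : ℕ} (Q : MvPowerSeries (Fin n) ℂ[X]) : MvPowerSeries (Fin n) ℂ⟦X⟧ :=
  MvPowerSeries.map (Polynomial.coeToPowerSeries.ringHom : ℂ[X] →+* ℂ⟦X⟧) Q

/-- `∂/∂t` on formal power series in `z` and `t`. -/
def timeDeriv {n : ℕ} (Q : MvPowerSeries (Fin n) ℂ⟦X⟧) : MvPowerSeries (Fin n) ℂ⟦X⟧ :=
  fun α => PowerSeries.derivative ℂ (MvPowerSeries.coeff α Q)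

/-- The value at `t = 0` of a formal power series in `z` and `t`. -/
def atZero {n : ℕ} (Q : MvPowerSeries (Fin n) ℂ⟦X⟧) : MvPowerSeries (Fin n) ℂ :=
  MvPowerSeries.map (PowerSeries.constantCoeff : ℂ⟦X⟧ →+* ℂ) Q

/-- `Q` solves the Cauchy problem `∂Q/∂t = (1/4) Δ_A (Q ^ 2)`, `Q|_{t=0} = P`. -/
def SolvesCauchy {n : ℕ} (A : Matrix (Fin n) (Fin n) ℂ) (P : MvPowerSeries (Fin n) ℂ)
    (Q : MvPowerSeries (Fin n) ℂ⟦X⟧) : Prop :=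
  timeDeriv Q = (1 / 4 : ℂ) • lap A (Q ^ 2) ∧ atZero Q = P

/-- The formal power series `∑_{m ≥ 0} t ^ m a_m(z)` in `z` and `t`: the coefficient of
`z ^ α t ^ m` is that of `z ^ α` in `a_m`. -/
def tSeries {n : ℕ} (a : ℕ → MvPowerSeries (Fin n) ℂ) : MvPowerSeries (Fin n) ℂ⟦X⟧ :=
  fun α => PowerSeries.mk fun m => MvPowerSeries.coeff α (a m)

end LaplaceInversion

end

/-!
Let `Q` be the formal solution of the Hamilton–Jacobi equation `∂Q/∂t = (1/2) ⟨∇Q, A ∇Q⟩` with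
`Q|_{t=0} = P` (`hj`); its gradient map `z + t A ∇Q` inverts `z - t A ∇P` for every `P`. The
nilpotency of `P` says that the Hopf–Cole transform of `Q` is free of quantum corrections: in
`exp (ħ t Δ_A / 2) exp (P / ħ)` no positive power of `ħ` occurs, the constant term is `1`, and the
coefficient `U_k` of `ħ⁻ᵏ` (`heat`) satisfies `∂U_k/∂t = (1/2) Δ_A U_{k+1}`. The claim
`U_k = Q ^ k / k!` is formula (b). The differences `d_k = U_k - Q ^ k / k!` satisfy
`∂d_k/∂t = (1/2) Δ_A d_{k+1} + (1/2) (Q ^ k / k!) Δ_A Q`. Since `d_0 = 0`, the equation for `k = 0`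
is `Δ_A Q = - Δ_A d_1`, which makes the system linear and homogeneous in the `d_k`; the initial
values vanish, so all `d_k` vanish, and `Δ_A Q = 0` as well
(`heat_eq_and_lap_hj_eq_zero`). As `Δ_A (Q²) = 2 Q Δ_A Q + 2 ⟨∇Q, A ∇Q⟩`, the Hamilton–Jacobi
equation is then the Cauchy problem of (a).

For the inverse map, the transport operator `∂/∂t - ⟨A ∇Q, ∇⟩` kills both `∇Q` and the components
of `G = z + t A ∇Q`, hence also `∇P(G)`; comparing initial values gives `∇Q = ∇P(G)`
(`pderiv_hj_eq_subst`), so that `G` is a right inverse of `z - t A ∇P`, and a right inverse is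
two-sided by a `t`-adic contraction (`subst_eq_X_of_right_inverse`).

The coefficients of `Q` are polynomials in `t`. The Jacobian of `G` at `z = 0` is the inverse of
`1 - t H A`, with `H` the Hessian of `P` at `0`, and `Δ_A Q = 0` says that its trace is `n`. By
Jacobi's formula the determinant of `1 - t H A` is constant in `t`, hence `1`
(`det_one_sub_hessMatrixSeries`), so the linear part of `z - t A ∇P` is invertible over `ℂ[t]`, and
the higher coefficients of `G` follow by induction on the degree
(`gradMap_hj_mem_coeffsBelow`).
-/

noncomputable section

namespace LaplaceInversion

open MvPowerSeries (coeff coeff_mul coeff_pderiv pderiv subst)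
open Finset.HasAntidiagonal (antidiagonal)

/-! ### Calculus on formal power series in `z` and `t` -/

section Calculus

variable {n : ℕ}

/-- The bilinear form `⟨∇f, A ∇g⟩ = ∑ i j, a_ij D_i f D_j g`. -/
def gradDot {R : Type*} [CommRing R] [Algebra ℂ R] (A : Matrix (Fin n) (Fin n) ℂ)
    (f g : MvPowerSeries (Fin n) R) : MvPowerSeries (Fin n) R :=
  ∑ i, ∑ j, A i j • (pderiv R i f * pderiv R j g)

section

variable {R : Type*} [CommRing R] [Algebra ℂ R] (A : Matrix (Fin n) (Fin n) ℂ)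

lemma lap_smul (c : ℂ) (f : MvPowerSeries (Fin n) R) : lap A (c • f) = c • lap A f := by
  simp only [lap, Finset.smul_sum, Derivation.map_smul_of_tower]
  exact Finset.sum_congr rfl fun i _ => Finset.sum_congr rfl fun j _ => smul_comm _ _ _

lemma lap_sub (f g : MvPowerSeries (Fin n) R) : lap A (f - g) = lap A f - lap A g := by
  simp [lap, smul_sub, Finset.sum_sub_distrib]

lemma lap_zero : lap A (0 : MvPowerSeries (Fin n) R) = 0 := by
  simp [lap]

lemma lap_pow (f : MvPowerSeries (Fin n) R) (k : ℕ) :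
    lap A (f ^ (k + 2)) = ((k : ℂ) + 2) • (f ^ (k + 1) * lap A f) +
      (((k : ℂ) + 2) * (k + 1)) • (f ^ k * gradDot A f f) := by
  simp only [lap, gradDot, Finset.mul_sum, Finset.smul_sum, ← Finset.sum_add_distrib]
  refine Finset.sum_congr rfl fun i _ => Finset.sum_congr rfl fun j _ => ?_
  have h : pderiv R i (pderiv R j (f ^ (k + 2))) =
      ((k : ℂ) + 2) • (f ^ (k + 1) * pderiv R i (pderiv R j f)) +
      (((k : ℂ) + 2) * (k + 1)) • (f ^ k * (pderiv R i f * pderiv R j f)) := by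
    simp only [MvPowerSeries.pderiv_pow, Derivation.leibniz, smul_eq_mul, Derivation.map_natCast,
      Nat.add_sub_cancel, show k + 2 - 1 = k + 1 by omega, Algebra.smul_def, map_add, map_mul,
      map_natCast, map_ofNat, map_one]
    push_cast
    ring
  rw [h, smul_add, smul_comm (A i j), smul_comm (A i j), mul_smul_comm, mul_smul_comm]

end

lemma coeff_timeDeriv (f : MvPowerSeries (Fin n) ℂ⟦X⟧) (α : Fin n →₀ ℕ) :
    coeff α (timeDeriv f) = PowerSeries.derivative ℂ (coeff α f) := rfl

lemma coeff_atZero (f : MvPowerSeries (Fin n) ℂ⟦X⟧) (α : Fin n →₀ ℕ) :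
    coeff α (atZero f) = PowerSeries.constantCoeff (coeff α f) := rfl

lemma coeff_tSeries (a : ℕ → MvPowerSeries (Fin n) ℂ) (α : Fin n →₀ ℕ) (m : ℕ) :
    PowerSeries.coeff m (coeff α (tSeries a)) = coeff α (a m) := by
  change PowerSeries.coeff m (PowerSeries.mk fun m => coeff α (a m)) = _
  rw [PowerSeries.coeff_mk]

/-- `∂/∂t` as a `ℂ`-linear derivation. -/
def timeDerivation : Derivation ℂ (MvPowerSeries (Fin n) ℂ⟦X⟧) (MvPowerSeries (Fin n) ℂ⟦X⟧) :=
  Derivation.mk'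
    { toFun := timeDeriv
      map_add' := fun f g => by ext1 α; simp [coeff_timeDeriv]
      map_smul' := fun c f => by ext1 α; simp [coeff_timeDeriv] }
    fun f g => by
      classical
      ext1 α
      change coeff α (timeDeriv (f * g)) = coeff α (f • timeDeriv g + g • timeDeriv f)
      rw [smul_eq_mul, smul_eq_mul, mul_comm g, map_add, coeff_timeDeriv, coeff_mul, coeff_mul,
        coeff_mul, map_sum, ← Finset.sum_add_distrib]
      refine Finset.sum_congr rfl fun p _ => ?_
      rw [Derivation.leibniz, coeff_timeDeriv, coeff_timeDeriv, smul_eq_mul, smul_eq_mul,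
        mul_comm (coeff p.2 g)]

lemma timeDerivation_apply (f : MvPowerSeries (Fin n) ℂ⟦X⟧) :
    timeDerivation f = timeDeriv f := rfl

lemma timeDeriv_add (f g : MvPowerSeries (Fin n) ℂ⟦X⟧) :
    timeDeriv (f + g) = timeDeriv f + timeDeriv g := map_add timeDerivation f g

lemma timeDeriv_sub (f g : MvPowerSeries (Fin n) ℂ⟦X⟧) :
    timeDeriv (f - g) = timeDeriv f - timeDeriv g := map_sub timeDerivation f g

lemma timeDeriv_smul (c : ℂ) (f : MvPowerSeries (Fin n) ℂ⟦X⟧) :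
    timeDeriv (c • f) = c • timeDeriv f := timeDerivation.map_smul c f

lemma timeDeriv_pow_succ (f : MvPowerSeries (Fin n) ℂ⟦X⟧) (k : ℕ) :
    timeDeriv (f ^ (k + 1)) = ((k : ℂ) + 1) • (f ^ k * timeDeriv f) := by
  have h := timeDerivation.leibniz_pow f (k + 1)
  rw [timeDerivation_apply, timeDerivation_apply, Nat.add_sub_cancel, smul_eq_mul,
    ← Nat.cast_smul_eq_nsmul ℂ] at h
  exact_mod_cast h

lemma timeDeriv_pderiv (f : MvPowerSeries (Fin n) ℂ⟦X⟧) (i : Fin n) :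
    timeDeriv (pderiv ℂ⟦X⟧ i f) = pderiv ℂ⟦X⟧ i (timeDeriv f) := by
  ext1 α
  rw [coeff_timeDeriv, coeff_pderiv, coeff_pderiv, coeff_timeDeriv, Derivation.leibniz]
  have h : PowerSeries.derivative ℂ ((α i : ℂ⟦X⟧) + 1) = 0 := by simp
  rw [h, smul_zero, zero_add, smul_eq_mul, mul_comm]

/-! ### Uniqueness for Cauchy problems in `t` -/

/-- Divisibility by `t ^ N`, coefficient by coefficient. -/
def TDvd (N : ℕ) (f : MvPowerSeries (Fin n) ℂ⟦X⟧) : Prop :=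
  ∀ α, (PowerSeries.X : ℂ⟦X⟧) ^ N ∣ coeff α f

namespace TDvd

variable {N : ℕ} {f g : MvPowerSeries (Fin n) ℂ⟦X⟧}

lemma zero_left (f : MvPowerSeries (Fin n) ℂ⟦X⟧) : TDvd 0 f := fun α => by simp

lemma add (hf : TDvd N f) (hg : TDvd N g) : TDvd N (f + g) := fun α => by
  rw [map_add]; exact dvd_add (hf α) (hg α)

lemma mul_left (g : MvPowerSeries (Fin n) ℂ⟦X⟧) (hf : TDvd N f) : TDvd N (g * f) := fun α => by
  classical
  rw [coeff_mul]
  exact Finset.dvd_sum fun p _ => (hf p.2).mul_left _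

lemma smul (c : ℂ) (hf : TDvd N f) : TDvd N (c • f) := by
  rw [Algebra.smul_def]; exact hf.mul_left _

lemma sum {ι : Type*} {s : Finset ι} {F : ι → MvPowerSeries (Fin n) ℂ⟦X⟧}
    (h : ∀ i ∈ s, TDvd N (F i)) : TDvd N (∑ i ∈ s, F i) := fun α => by
  rw [map_sum]; exact Finset.dvd_sum fun i hi => h i hi α

lemma pderiv (i : Fin n) (hf : TDvd N f) : TDvd N (pderiv ℂ⟦X⟧ i f) := fun α => by
  rw [coeff_pderiv]; exact (hf _).mul_right _

lemma lap (A : Matrix (Fin n) (Fin n) ℂ) (hf : TDvd N f) : TDvd N (lap A f) :=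
  sum fun i _ => sum fun j _ => ((hf.pderiv j).pderiv i).smul _

lemma eq_zero (h : ∀ N, TDvd N f) : f = 0 := by
  ext α m
  have := PowerSeries.X_pow_dvd_iff.mp (h (m + 1) α) m (Nat.lt_succ_self m)
  simpa using this

/-- Integration in `t` raises the order in `t` by one, provided the initial value vanishes. -/
lemma succ_of_timeDeriv (h0 : atZero f = 0) (h : TDvd N (timeDeriv f)) : TDvd (N + 1) f := by
  intro α
  rw [PowerSeries.X_pow_dvd_iff]
  rintro (_ | m) hm
  · rw [PowerSeries.coeff_zero_eq_constantCoeff_apply, ← coeff_atZero, h0, map_zero]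
  · have h1 := PowerSeries.X_pow_dvd_iff.mp (h α) m (by omega)
    rw [coeff_timeDeriv, PowerSeries.coeff_derivative] at h1
    exact (mul_eq_zero.mp h1).resolve_right (by exact_mod_cast Nat.succ_ne_zero m)

end TDvd

/-- Uniqueness for a homogeneous linear Cauchy problem in `t`, possibly an infinite system: the
hypothesis `h` says that the right-hand side does not lower the order in `t`. -/
lemma eq_zero_of_cauchy {ι : Type*} (w : ι → MvPowerSeries (Fin n) ℂ⟦X⟧)
    (h0 : ∀ k, atZero (w k) = 0)
    (h : ∀ N, (∀ k, TDvd N (w k)) → ∀ k, TDvd N (timeDeriv (w k))) (k : ι) : w k = 0 := by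
  have key : ∀ N, ∀ k, TDvd N (w k) := fun N => by
    induction N with
    | zero => exact fun k => TDvd.zero_left _
    | succ N ih => exact fun k => TDvd.succ_of_timeDeriv (h0 k) (h N ih k)
  exact TDvd.eq_zero fun N => key N k

lemma atZero_sub (f g : MvPowerSeries (Fin n) ℂ⟦X⟧) : atZero (f - g) = atZero f - atZero g :=
  map_sub _ _ _

lemma atZero_pow (f : MvPowerSeries (Fin n) ℂ⟦X⟧) (k : ℕ) : atZero (f ^ k) = atZero f ^ k :=
  map_pow _ _ _

lemma atZero_smul (c : ℂ) (f : MvPowerSeries (Fin n) ℂ⟦X⟧) : atZero (c • f) = c • atZero f := by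
  ext α
  simp [coeff_atZero, PowerSeries.smul_eq_C_mul]

lemma atZero_pderiv (f : MvPowerSeries (Fin n) ℂ⟦X⟧) (i : Fin n) :
    atZero (pderiv ℂ⟦X⟧ i f) = pderiv ℂ i (atZero f) := by
  ext α
  simp [coeff_atZero, coeff_pderiv]

/-! ### Power series in `t` with coefficients in `ℂ⟦z⟧` -/

lemma tSeries_mul (a b : ℕ → MvPowerSeries (Fin n) ℂ) :
    tSeries a * tSeries b = tSeries fun m => ∑ p ∈ antidiagonal m, a p.1 * b p.2 := by
  classical
  ext α m
  rw [coeff_tSeries, coeff_mul, map_sum, map_sum]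
  simp only [PowerSeries.coeff_mul, coeff_mul, coeff_tSeries]
  exact Finset.sum_comm

lemma tSeries_smul (c : ℂ) (a : ℕ → MvPowerSeries (Fin n) ℂ) :
    c • tSeries a = tSeries fun m => c • a m := by
  ext α m
  simp [coeff_tSeries]

lemma tSeries_sum {ι : Type*} (s : Finset ι) (a : ι → ℕ → MvPowerSeries (Fin n) ℂ) :
    ∑ i ∈ s, tSeries (a i) = tSeries fun m => ∑ i ∈ s, a i m := by
  ext α m
  simp [coeff_tSeries]

lemma pderiv_tSeries (i : Fin n) (a : ℕ → MvPowerSeries (Fin n) ℂ) :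
    pderiv ℂ⟦X⟧ i (tSeries a) = tSeries fun m => pderiv ℂ i (a m) := by
  ext α m
  have h : ((α i : ℂ⟦X⟧) + 1) = PowerSeries.C ((α i : ℂ) + 1) := by simp
  rw [coeff_tSeries, coeff_pderiv, coeff_pderiv, h, PowerSeries.coeff_mul_C, coeff_tSeries]

lemma lap_tSeries (A : Matrix (Fin n) (Fin n) ℂ) (a : ℕ → MvPowerSeries (Fin n) ℂ) :
    lap A (tSeries a) = tSeries fun m => lap A (a m) := by
  simp only [lap, pderiv_tSeries, tSeries_smul, tSeries_sum]

lemma gradDot_tSeries (A : Matrix (Fin n) (Fin n) ℂ) (a b : ℕ → MvPowerSeries (Fin n) ℂ) :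
    gradDot A (tSeries a) (tSeries b) =
      tSeries fun m => ∑ p ∈ antidiagonal m, gradDot A (a p.1) (b p.2) := by
  simp only [gradDot, pderiv_tSeries, tSeries_mul, tSeries_smul, tSeries_sum]
  refine congrArg tSeries (funext fun m => ?_)
  symm
  rw [Finset.sum_comm]
  refine Finset.sum_congr rfl fun i _ => ?_
  rw [Finset.sum_comm]
  exact Finset.sum_congr rfl fun j _ => Finset.smul_sum.symm

lemma timeDeriv_tSeries (a : ℕ → MvPowerSeries (Fin n) ℂ) :
    timeDeriv (tSeries a) = tSeries fun m => ((m : ℂ) + 1) • a (m + 1) := by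
  ext α m
  simp [coeff_tSeries, coeff_timeDeriv, PowerSeries.coeff_derivative, mul_comm]

lemma atZero_tSeries (a : ℕ → MvPowerSeries (Fin n) ℂ) : atZero (tSeries a) = a 0 := by
  ext α
  rw [coeff_atZero, ← PowerSeries.coeff_zero_eq_constantCoeff_apply, coeff_tSeries]

end Calculus

/-! ### The Hamilton–Jacobi equation -/

section HamiltonJacobi

variable {n : ℕ} (A : Matrix (Fin n) (Fin n) ℂ) (P : MvPowerSeries (Fin n) ℂ)

/-- The coefficients `q_m ∈ ℂ⟦z⟧` of the solution `∑ t ^ m q_m` of the Hamilton–Jacobi equation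
`∂Q/∂t = (1/2) ⟨∇Q, A ∇Q⟩`, `Q|_{t=0} = P`, defined by comparing coefficients of `t ^ m`. -/
def hjCoeff : ℕ → MvPowerSeries (Fin n) ℂ
  | 0 => P
  | m + 1 => (1 / (2 * ((m : ℂ) + 1))) •
      ∑ i : Fin (m + 1), gradDot A (hjCoeff i) (hjCoeff (m - i))
  decreasing_by all_goals omega

/-- The solution of the Hamilton–Jacobi equation `∂Q/∂t = (1/2) ⟨∇Q, A ∇Q⟩` with initial
value `P`. -/
def hj : MvPowerSeries (Fin n) ℂ⟦X⟧ := tSeries (hjCoeff A P)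

lemma atZero_hj : atZero (hj A P) = P := by
  rw [hj, atZero_tSeries, hjCoeff]

lemma timeDeriv_hj : timeDeriv (hj A P) = (1 / 2 : ℂ) • gradDot A (hj A P) (hj A P) := by
  rw [hj, timeDeriv_tSeries, gradDot_tSeries, tSeries_smul]
  congr 1
  funext m
  rw [hjCoeff, smul_smul, Finset.Nat.sum_antidiagonal_eq_sum_range_succ_mk,
    Finset.sum_range (fun k => gradDot A (hjCoeff A P (k, m - k).1) (hjCoeff A P (k, m - k).2))]
  congr 1
  have : (m : ℂ) + 1 ≠ 0 := by exact_mod_cast Nat.succ_ne_zero m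
  field_simp

/-! ### The heat hierarchy and the vanishing of `Δ_A Q` -/

/-- The `ħ⁻ᵏ`-coefficient of `exp (ħ t Δ_A / 2) exp (P / ħ)`. -/
def heat (k : ℕ) : MvPowerSeries (Fin n) ℂ⟦X⟧ :=
  tSeries fun m => (1 / (2 ^ m * (m ! : ℂ) * ((m + k)! : ℂ))) • (lap A)^[m] (P ^ (m + k))

lemma atZero_heat (k : ℕ) : atZero (heat A P k) = (1 / (k ! : ℂ)) • P ^ k := by
  simp [heat, atZero_tSeries]

lemma timeDeriv_heat (k : ℕ) : timeDeriv (heat A P k) = (1 / 2 : ℂ) • lap A (heat A P (k + 1)) := by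
  rw [heat, heat, timeDeriv_tSeries, lap_tSeries, tSeries_smul]
  congr 1
  funext m
  rw [lap_smul, smul_smul, smul_smul, Function.iterate_succ_apply',
    show m + 1 + k = m + (k + 1) by ring]
  congr 1
  rw [Nat.factorial_succ m]
  have : (m : ℂ) + 1 ≠ 0 := by exact_mod_cast Nat.succ_ne_zero m
  have : (m ! : ℂ) ≠ 0 := by exact_mod_cast m.factorial_ne_zero
  have : ((m + (k + 1))! : ℂ) ≠ 0 := by exact_mod_cast Nat.factorial_ne_zero _
  push_cast
  field_simp
  ring

variable {A P}

lemma heat_zero (hP : IsLapNilpotent A P) : heat A P 0 = 1 := by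
  classical
  ext α m
  rw [heat, coeff_tSeries]
  rcases m with _ | m
  · simp [MvPowerSeries.coeff_one, apply_ite, PowerSeries.coeff_one]
  · rw [add_zero, hP (m + 1) (by omega), smul_zero, map_zero, MvPowerSeries.coeff_one]
    split_ifs <;> simp [PowerSeries.coeff_one]

/-- The evolution of the difference of the two candidates for the `ħ⁻ᵏ`-coefficient of
`exp (Q / ħ)`. -/
lemma timeDeriv_heat_sub (k : ℕ) :
    timeDeriv (heat A P k - (1 / (k ! : ℂ)) • hj A P ^ k) =
      (1 / 2 : ℂ) • lap A (heat A P (k + 1) - (1 / ((k + 1)! : ℂ)) • hj A P ^ (k + 1)) +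
      (1 / 2 : ℂ) • (1 / (k ! : ℂ)) • (hj A P ^ k * lap A (hj A P)) := by
  rw [timeDeriv_sub, timeDeriv_smul, timeDeriv_heat, lap_sub, lap_smul]
  rcases k with _ | k
  · have : timeDeriv (1 : MvPowerSeries (Fin n) ℂ⟦X⟧) = 0 := timeDerivation.map_one_eq_zero
    simp [this, smul_sub]
  · have h1 : (k : ℂ) + 1 ≠ 0 := by exact_mod_cast Nat.succ_ne_zero k
    have h2 : (k : ℂ) + 2 ≠ 0 := by exact_mod_cast Nat.succ_ne_zero (k + 1)
    have h3 : (k ! : ℂ) ≠ 0 := by exact_mod_cast k.factorial_ne_zero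
    have h4 : ((k + 1 + 1)! : ℂ) = (k + 2) * ((k + 1) * k !) := by
      rw [Nat.factorial_succ, Nat.factorial_succ]; push_cast; ring
    have h5 : ((k + 1)! : ℂ) = (k + 1) * k ! := by
      rw [Nat.factorial_succ]; push_cast; ring
    rw [timeDeriv_pow_succ, timeDeriv_hj, lap_pow, h4, h5, mul_smul_comm]
    match_scalars <;> (field_simp; try ring)

/-- If `P` is `Δ_A`-nilpotent, the differences `d_k = U_k - Q ^ k / k!`, with `U_k` the series
`heat A P k`, satisfy the homogeneous linear system
`∂d_k/∂t = (1/2) Δ_A d_{k+1} - (1/2) (Q ^ k / k!) Δ_A d_1` with zero initial values: the case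
`k = 0` of `timeDeriv_heat_sub`, where `d_0 = 0`, reads `Δ_A Q = - Δ_A d_1`. -/
theorem heat_eq_and_lap_hj_eq_zero (hP : IsLapNilpotent A P) :
    (∀ k, heat A P k = (1 / (k ! : ℂ)) • hj A P ^ k) ∧ lap A (hj A P) = 0 := by
  set d : ℕ → MvPowerSeries (Fin n) ℂ⟦X⟧ :=
    fun k => heat A P k - (1 / (k ! : ℂ)) • hj A P ^ k with hd
  have d0 : d 0 = 0 := by simp [hd, heat_zero hP]
  have hdt : ∀ k, timeDeriv (d k) = (1 / 2 : ℂ) • lap A (d (k + 1)) +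
      (1 / 2 : ℂ) • (1 / (k ! : ℂ)) • (hj A P ^ k * lap A (hj A P)) := timeDeriv_heat_sub
  have hlap : lap A (hj A P) = (-1 : ℂ) • lap A (d 1) := by
    have h := hdt 0
    rw [d0, show timeDeriv (0 : MvPowerSeries (Fin n) ℂ⟦X⟧) = 0 from timeDerivation.map_zero] at h
    have h' := congrArg (fun x => (2 : ℂ) • x) h
    simp only [smul_zero, smul_add, smul_smul] at h'
    norm_num at h'
    rw [neg_one_smul]
    exact eq_neg_of_add_eq_zero_right h'.symm
  have hd0 : ∀ k, d k = 0 := by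
    refine eq_zero_of_cauchy d (fun k => ?_) fun N hN k => ?_
    · simp only [hd]
      rw [atZero_sub, atZero_heat, atZero_smul, atZero_pow, atZero_hj, sub_self]
    · rw [hdt, hlap]
      exact (((hN _).lap A).smul _).add
        ((((((hN 1).lap A).smul _).mul_left _).smul _).smul _)
  exact ⟨fun k => sub_eq_zero.mp (hd0 k), by rw [hlap, hd0 1, lap_zero, smul_zero]⟩

lemma solvesCauchy_hj (hP : IsLapNilpotent A P) : SolvesCauchy A P (hj A P) := by
  refine ⟨?_, atZero_hj A P⟩
  rw [timeDeriv_hj, show 2 = 0 + 2 from rfl, lap_pow, (heat_eq_and_lap_hj_eq_zero hP).2]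
  simp only [mul_zero, smul_zero, zero_add, pow_zero, one_mul, smul_smul]
  norm_num

lemma SolvesCauchy.unique {Q Q' : MvPowerSeries (Fin n) ℂ⟦X⟧} (h : SolvesCauchy A P Q)
    (h' : SolvesCauchy A P Q') : Q' = Q := by
  rw [← sub_eq_zero]
  refine eq_zero_of_cauchy (fun _ : Unit => Q' - Q) (fun _ => ?_) (fun N hN _ => ?_) ()
  · rw [atZero_sub, h.2, h'.2, sub_self]
  · rw [timeDeriv_sub, h.1, h'.1, ← smul_sub, ← lap_sub, sq_sub_sq]
    exact (((hN ()).mul_left _).lap A).smul _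

/-- All powers of the solution of the Cauchy problem, in closed form. -/
lemma hj_pow (hP : IsLapNilpotent A P) (k : ℕ) :
    hj A P ^ k = tSeries fun m => ((k ! : ℂ) / (2 ^ m * (m ! : ℂ) * ((m + k)! : ℂ))) •
      (lap A)^[m] (P ^ (m + k)) := by
  have h := congrArg (fun x => (k ! : ℂ) • x) ((heat_eq_and_lap_hj_eq_zero hP).1 k)
  have h3 : (k ! : ℂ) ≠ 0 := by exact_mod_cast k.factorial_ne_zero
  simp only [smul_smul, mul_one_div_cancel h3, one_smul] at h
  rw [← h, heat, tSeries_smul]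
  simp only [smul_smul, mul_one_div]

end HamiltonJacobi

/-! ### Substitution and derivations -/

section Substitution

variable {n : ℕ}

lemma pderiv_comm {R : Type*} [CommRing R] (i j : Fin n) (f : MvPowerSeries (Fin n) R) :
    pderiv R i (pderiv R j f) = pderiv R j (pderiv R i f) := by
  classical
  ext α
  simp only [coeff_pderiv, Finsupp.add_apply, Finsupp.single_apply]
  rw [add_right_comm]
  by_cases h : i = j
  · subst h; ring
  · rw [if_neg h, if_neg (Ne.symm h)]; push_cast; ring

lemma le_order_pderiv {R : Type*} [CommRing R] {N : ℕ} {f : MvPowerSeries (Fin n) R}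
    (hf : ((N + 1 : ℕ) : ℕ∞) ≤ f.order) (i : Fin n) : (N : ℕ∞) ≤ (pderiv R i f).order := by
  refine MvPowerSeries.nat_le_order fun d hd => ?_
  rw [coeff_pderiv, MvPowerSeries.coeff_of_lt_order, zero_mul]
  refine lt_of_lt_of_le ?_ hf
  rw [map_add, Finsupp.degree_single]
  exact_mod_cast Nat.add_lt_add_right hd 1

lemma le_order_timeDeriv {N : ℕ} {f : MvPowerSeries (Fin n) ℂ⟦X⟧}
    (hf : (N : ℕ∞) ≤ f.order) : (N : ℕ∞) ≤ (timeDeriv f).order := by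
  refine MvPowerSeries.nat_le_order fun d hd => ?_
  rw [coeff_timeDeriv, MvPowerSeries.coeff_of_lt_order, map_zero]
  exact lt_of_lt_of_le (by exact_mod_cast hd) hf

lemma subst_map_algebraMap {R S : Type*} [CommRing R] [CommRing S] [Algebra R S]
    {G : Fin n → MvPowerSeries (Fin n) S} (hG : MvPowerSeries.HasSubst G)
    (f : MvPowerSeries (Fin n) R) :
    subst G (MvPowerSeries.map (algebraMap R S) f) = subst G f := by
  rw [MvPowerSeries.map_algebraMap_eq_subst_X,
    MvPowerSeries.subst_comp_subst_apply MvPowerSeries.HasSubst.X hG]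
  simp only [MvPowerSeries.subst_X hG]

/-- A derivation `L` of `ℂ⟦t⟧⟦z⟧` that lowers the order in `z` by at most one and kills all `G i`
kills every `f(G)` with `f ∈ ℂ⟦z⟧`: this holds for polynomials `f`, and `L (f(G))` is determined
up to any given order by a truncation of `f`. -/
lemma derivation_subst_eq_zero
    (L : Derivation ℂ (MvPowerSeries (Fin n) ℂ⟦X⟧) (MvPowerSeries (Fin n) ℂ⟦X⟧))
    (hL : ∀ (N : ℕ) f, ((N + 1 : ℕ) : ℕ∞) ≤ MvPowerSeries.order f → (N : ℕ∞) ≤ (L f).order)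
    {G : Fin n → MvPowerSeries (Fin n) ℂ⟦X⟧}
    (hG : ∀ i, MvPowerSeries.constantCoeff (G i) = 0) (hLG : ∀ i, L (G i) = 0)
    (f : MvPowerSeries (Fin n) ℂ) : L (subst G f) = 0 := by
  have hs : MvPowerSeries.HasSubst G := MvPowerSeries.hasSubst_of_constantCoeff_zero hG
  have hpoly : ∀ p : MvPolynomial (Fin n) ℂ, L (MvPolynomial.aeval G p) = 0 := fun p => by
    induction p using MvPolynomial.induction_on with
    | C a => rw [MvPolynomial.aeval_C, Derivation.map_algebraMap]
    | add p q hp hq => rw [map_add, map_add, hp, hq, add_zero]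
    | mul_X p i hp =>
      rw [map_mul, Derivation.leibniz, hp, MvPolynomial.aeval_X, hLG, smul_zero, smul_zero,
        add_zero]
  ext1 e
  set N := Finsupp.degree e + 2 with hN
  set r : MvPowerSeries (Fin n) ℂ := f - (MvPowerSeries.truncTotal N f : MvPolynomial _ ℂ) with hr
  have hrord : (N : ℕ∞) ≤ r.order := MvPowerSeries.nat_le_order fun d hd => by
    rw [hr, map_sub, MvPolynomial.coeff_coe, MvPowerSeries.coeff_truncTotal _ hd, sub_self]
  have hsub : (N : ℕ∞) ≤ (subst G r).order := by
    refine le_trans ?_ (MvPowerSeries.le_order_subst hs r)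
    have h1 : (1 : ℕ∞) ≤ ⨅ i, (G i).order :=
      le_iInf fun i => MvPowerSeries.one_le_order_iff_constCoeff_eq_zero.mpr (hG i)
    calc (N : ℕ∞) ≤ r.order := hrord
      _ = 1 * r.order := (one_mul _).symm
      _ ≤ _ := by gcongr
  have hf : f = (MvPowerSeries.truncTotal N f : MvPolynomial _ ℂ) + r := by rw [hr]; ring
  rw [hf, MvPowerSeries.subst_add hs, map_add, MvPowerSeries.subst_coe, hpoly, zero_add, map_zero]
  refine MvPowerSeries.coeff_of_lt_order (lt_of_lt_of_le ?_ (hL (N - 1) _ ?_))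
  · exact_mod_cast (by omega : Finsupp.degree e < N - 1)
  · rwa [show N - 1 + 1 = N by omega]

lemma atZero_subst {G : Fin n → MvPowerSeries (Fin n) ℂ⟦X⟧}
    (hG : MvPowerSeries.HasSubst G) (hG0 : ∀ i, atZero (G i) = MvPowerSeries.X i)
    (f : MvPowerSeries (Fin n) ℂ) : atZero (subst G f) = f := by
  rw [← subst_map_algebraMap hG, atZero, MvPowerSeries.map_subst hG]
  have h1 : (fun i => MvPowerSeries.map PowerSeries.constantCoeff (G i)) =
      (MvPowerSeries.X : Fin n → MvPowerSeries (Fin n) ℂ) := funext hG0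
  have h2 : MvPowerSeries.map PowerSeries.constantCoeff
      (MvPowerSeries.map (algebraMap ℂ ℂ⟦X⟧) f) = f := by
    ext α; simp
  rw [h1, h2, MvPowerSeries.subst_self, id]

lemma tdvd_iff_map_eq_zero {N : ℕ} {f : MvPowerSeries (Fin n) ℂ⟦X⟧} :
    TDvd N f ↔ MvPowerSeries.map
      (Ideal.Quotient.mk (Ideal.span {(PowerSeries.X : ℂ⟦X⟧) ^ N})) f = 0 := by
  constructor
  · intro h
    ext α
    rw [MvPowerSeries.coeff_map, map_zero, Ideal.Quotient.eq_zero_iff_dvd]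
    exact h α
  · intro h α
    have := congrArg (coeff α) h
    rwa [MvPowerSeries.coeff_map, map_zero, Ideal.Quotient.eq_zero_iff_dvd] at this

/-- Substitution respects congruences modulo `t ^ N`. -/
lemma TDvd.subst_sub {N : ℕ} {H : Fin n → MvPowerSeries (Fin n) ℂ⟦X⟧}
    (hs : MvPowerSeries.HasSubst H) (h : ∀ i, TDvd N (H i - MvPowerSeries.X i))
    (f : MvPowerSeries (Fin n) ℂ⟦X⟧) : TDvd N (subst H f - f) := by
  rw [tdvd_iff_map_eq_zero, map_sub, MvPowerSeries.map_subst hs]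
  have h1 : (fun i => MvPowerSeries.map
      (Ideal.Quotient.mk (Ideal.span {(PowerSeries.X : ℂ⟦X⟧) ^ N})) (H i)) =
      MvPowerSeries.X := funext fun i => by
    have := tdvd_iff_map_eq_zero.mp (h i)
    rwa [map_sub, sub_eq_zero, MvPowerSeries.map_X] at this
  rw [h1, MvPowerSeries.subst_self, id, sub_self]

lemma TDvd.X_smul {N : ℕ} {f : MvPowerSeries (Fin n) ℂ⟦X⟧} (h : TDvd N f) :
    TDvd (N + 1) ((PowerSeries.X : ℂ⟦X⟧) • f) := fun α => by
  rw [map_smul, smul_eq_mul, pow_succ']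
  exact mul_dvd_mul_left _ (h α)

lemma timeDeriv_X_smul (f : MvPowerSeries (Fin n) ℂ⟦X⟧) :
    timeDeriv ((PowerSeries.X : ℂ⟦X⟧) • f) = f + (PowerSeries.X : ℂ⟦X⟧) • timeDeriv f := by
  ext1 α
  have h : ∀ g : MvPowerSeries (Fin n) ℂ⟦X⟧,
      coeff α ((PowerSeries.X : ℂ⟦X⟧) • g) = PowerSeries.X * coeff α g := fun g => by
    rw [map_smul, smul_eq_mul]
  rw [coeff_timeDeriv, map_add, h, h, coeff_timeDeriv, Derivation.leibniz,
    PowerSeries.derivative_X, smul_eq_mul, smul_eq_mul, mul_one, add_comm]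

/-- If `F = z + t g` has the right inverse `G`, then `G` is also a left inverse: `H = G ∘ F`
satisfies `F ∘ H = F`, so `H - z = t (g - g ∘ H)` vanishes modulo every power of `t`. -/
lemma subst_eq_X_of_right_inverse {F G g : Fin n → MvPowerSeries (Fin n) ℂ⟦X⟧}
    (hF : ∀ i, MvPowerSeries.constantCoeff (F i) = 0)
    (hG : ∀ i, MvPowerSeries.constantCoeff (G i) = 0)
    (hFg : ∀ i, F i = MvPowerSeries.X i + (PowerSeries.X : ℂ⟦X⟧) • g i)
    (h : ∀ i, subst G (F i) = MvPowerSeries.X i) (i : Fin n) :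
    subst F (G i) = MvPowerSeries.X i := by
  have hsF := MvPowerSeries.hasSubst_of_constantCoeff_zero hF
  have hsG := MvPowerSeries.hasSubst_of_constantCoeff_zero hG
  set H : Fin n → MvPowerSeries (Fin n) ℂ⟦X⟧ := fun j => subst F (G j) with hH
  have hsH : MvPowerSeries.HasSubst H := MvPowerSeries.hasSubst_of_constantCoeff_zero fun j =>
    MvPowerSeries.constantCoeff_subst_eq_zero hsF hF (hG j)
  have hFH : ∀ j, subst H (F j) = F j := fun j => by
    rw [hH, ← MvPowerSeries.subst_comp_subst_apply hsG hsF, h, MvPowerSeries.subst_X hsF]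
  have hdiff : ∀ j, H j - MvPowerSeries.X j =
      (-1 : ℂ) • (PowerSeries.X : ℂ⟦X⟧) • (subst H (g j) - g j) := fun j => by
    have := hFH j
    rw [hFg, MvPowerSeries.subst_add hsH, MvPowerSeries.subst_X hsH,
      MvPowerSeries.subst_smul hsH] at this
    rw [neg_one_smul, smul_sub, neg_sub, sub_eq_sub_iff_add_eq_add, this, add_comm]
  have key : ∀ N : ℕ, ∀ j, TDvd N (H j - MvPowerSeries.X j) := by
    intro N
    induction N with
    | zero => exact fun j => TDvd.zero_left _
    | succ N ih =>
      intro j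
      rw [hdiff]
      exact (TDvd.subst_sub hsH ih (g j)).X_smul.smul _
  exact sub_eq_zero.mp (TDvd.eq_zero fun N => key N i)

end Substitution

/-! ### The gradient map of the Hamilton–Jacobi solution as formal inverse -/

section Inverse

variable {n : ℕ} (A : Matrix (Fin n) (Fin n) ℂ) (P : MvPowerSeries (Fin n) ℂ)

/-- The transport operator `∂/∂t - ⟨A ∇Q, ∇⟩` along the gradient of `Q`. -/
def transport (Q : MvPowerSeries (Fin n) ℂ⟦X⟧) :
    Derivation ℂ (MvPowerSeries (Fin n) ℂ⟦X⟧) (MvPowerSeries (Fin n) ℂ⟦X⟧) :=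
  timeDerivation - ∑ k, mulGrad A Q k • (pderiv ℂ⟦X⟧ k).restrictScalars ℂ

lemma transport_apply (Q f : MvPowerSeries (Fin n) ℂ⟦X⟧) :
    transport A Q f = timeDeriv f - ∑ k, mulGrad A Q k * pderiv ℂ⟦X⟧ k f := by
  let ev : Derivation ℂ (MvPowerSeries (Fin n) ℂ⟦X⟧) (MvPowerSeries (Fin n) ℂ⟦X⟧) →+
      MvPowerSeries (Fin n) ℂ⟦X⟧ :=
    (Pi.evalAddMonoidHom _ f).comp Derivation.coeFnAddMonoidHom
  have h := map_sum ev (fun k => mulGrad A Q k • (pderiv ℂ⟦X⟧ k).restrictScalars ℂ) Finset.univ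
  exact congrArg (timeDeriv f - ·) h

lemma le_order_transport (Q : MvPowerSeries (Fin n) ℂ⟦X⟧) (N : ℕ) (f : MvPowerSeries (Fin n) ℂ⟦X⟧)
    (hf : ((N + 1 : ℕ) : ℕ∞) ≤ f.order) : (N : ℕ∞) ≤ (transport A Q f).order := by
  refine MvPowerSeries.nat_le_order fun d hd => ?_
  have h1 : coeff d (timeDeriv f) = 0 := MvPowerSeries.coeff_of_lt_order <|
    lt_of_lt_of_le (by exact_mod_cast hd.trans (Nat.lt_succ_self N)) (le_order_timeDeriv hf)
  rw [transport_apply, map_sub, h1, map_sum, zero_sub, neg_eq_zero]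
  refine Finset.sum_eq_zero fun k _ => MvPowerSeries.coeff_of_lt_order ?_
  refine lt_of_lt_of_le (?_ : _ < (N : ℕ∞)) ((le_order_pderiv hf k).trans ?_)
  · exact_mod_cast hd
  · exact le_trans le_add_self MvPowerSeries.le_order_mul

/-- Two solutions of the transport equation with the same initial value are equal. -/
lemma eq_of_transport_eq_zero {Q f g : MvPowerSeries (Fin n) ℂ⟦X⟧} (hf : transport A Q f = 0)
    (hg : transport A Q g = 0) (h0 : atZero f = atZero g) : f = g := by
  rw [← sub_eq_zero]
  refine eq_zero_of_cauchy (fun _ : Unit => f - g) (fun _ => ?_) (fun N hN _ => ?_) ()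
  · rw [atZero_sub, h0, sub_self]
  · have h : transport A Q (f - g) = 0 := by rw [map_sub, hf, hg, sub_self]
    rw [transport_apply, sub_eq_zero] at h
    rw [h]
    exact TDvd.sum fun k _ => ((hN ()).pderiv k).mul_left _

variable {A P}

lemma transport_pderiv_hj (hA : A.IsSymm) (i : Fin n) :
    transport A (hj A P) (pderiv ℂ⟦X⟧ i (hj A P)) = 0 := by
  rw [transport_apply, timeDeriv_pderiv, timeDeriv_hj, sub_eq_zero]
  set Q := hj A P
  have h1 : pderiv ℂ⟦X⟧ i (gradDot A Q Q) =
      (∑ k, ∑ j, A k j • (pderiv ℂ⟦X⟧ k Q * pderiv ℂ⟦X⟧ j (pderiv ℂ⟦X⟧ i Q))) +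
      ∑ k, ∑ j, A k j • (pderiv ℂ⟦X⟧ j Q * pderiv ℂ⟦X⟧ k (pderiv ℂ⟦X⟧ i Q)) := by
    simp only [gradDot, map_sum, Derivation.map_smul_of_tower, Derivation.leibniz, smul_eq_mul,
      smul_add, Finset.sum_add_distrib, pderiv_comm i]
  have h2 : (∑ k, ∑ j, A k j • (pderiv ℂ⟦X⟧ k Q * pderiv ℂ⟦X⟧ j (pderiv ℂ⟦X⟧ i Q))) =
      ∑ k, ∑ j, A k j • (pderiv ℂ⟦X⟧ j Q * pderiv ℂ⟦X⟧ k (pderiv ℂ⟦X⟧ i Q)) := by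
    rw [Finset.sum_comm]
    exact Finset.sum_congr rfl fun k _ => Finset.sum_congr rfl fun j _ => by rw [hA.apply k j]
  rw [Derivation.map_smul_of_tower, h1, h2, ← two_smul ℂ, smul_smul]
  norm_num
  simp only [mulGrad, Finset.sum_mul, smul_mul_assoc]

/-- The map `z + t A ∇Q` over `ℂ⟦t⟧`. -/
def gradMap (A : Matrix (Fin n) (Fin n) ℂ) (Q : MvPowerSeries (Fin n) ℂ⟦X⟧) (i : Fin n) :
    MvPowerSeries (Fin n) ℂ⟦X⟧ :=
  MvPowerSeries.X i + (PowerSeries.X : ℂ⟦X⟧) • mulGrad A Q i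

lemma transport_gradMap_hj (hA : A.IsSymm) (i : Fin n) :
    transport A (hj A P) (gradMap A (hj A P) i) = 0 := by
  classical
  have h1 : transport A (hj A P) (mulGrad A (hj A P) i) = 0 := by
    simp only [mulGrad, map_sum, Derivation.map_smul, transport_pderiv_hj hA, smul_zero,
      Finset.sum_const_zero]
  rw [transport_apply, sub_eq_zero] at h1
  rw [gradMap, transport_apply, timeDeriv_add, timeDeriv_X_smul, h1]
  have h2 : timeDeriv (MvPowerSeries.X i : MvPowerSeries (Fin n) ℂ⟦X⟧) = 0 := by
    ext1 α
    rw [coeff_timeDeriv, MvPowerSeries.coeff_X]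
    split_ifs <;> simp
  simp only [h2, map_add, Derivation.map_smul, mul_add, Finset.sum_add_distrib, mul_smul_comm,
    ← Finset.smul_sum, MvPowerSeries.pderiv_X, Pi.single_apply, mul_ite, mul_one, mul_zero]
  simp

lemma two_le_order_hjCoeff (hord : 2 ≤ P.order) (m : ℕ) : 2 ≤ (hjCoeff A P m).order := by
  induction m using Nat.strong_induction_on with
  | _ m ih =>
    rcases m with _ | m
    · rwa [hjCoeff]
    · have hp : ∀ k < m + 1, ∀ i, (1 : ℕ∞) ≤ (pderiv ℂ i (hjCoeff A P k)).order := fun k hk i =>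
        by exact_mod_cast le_order_pderiv (N := 1) (by exact_mod_cast ih k hk) i
      refine MvPowerSeries.nat_le_order (n := 2) fun d hd => ?_
      rw [hjCoeff, map_smul, map_sum, Finset.sum_eq_zero, smul_zero]
      intro k _
      simp only [gradDot, map_sum, map_smul]
      refine Finset.sum_eq_zero fun i _ => Finset.sum_eq_zero fun j _ => ?_
      rw [MvPowerSeries.coeff_of_lt_order, smul_zero]
      refine lt_of_lt_of_le (by exact_mod_cast hd : _ < (2 : ℕ∞))
        (le_trans ?_ MvPowerSeries.le_order_mul)
      rw [← one_add_one_eq_two]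
      exact add_le_add (hp _ k.2 i) (hp _ (by omega) j)

lemma two_le_order_hj (hord : 2 ≤ P.order) : 2 ≤ (hj A P).order := by
  refine MvPowerSeries.nat_le_order (n := 2) fun d hd => ?_
  ext m
  rw [hj, coeff_tSeries, map_zero, MvPowerSeries.coeff_of_lt_order]
  exact lt_of_lt_of_le (by exact_mod_cast hd) (two_le_order_hjCoeff hord m)

lemma constantCoeff_pderiv_eq_zero {R : Type*} [CommRing R] {f : MvPowerSeries (Fin n) R}
    (hf : 2 ≤ f.order) (i : Fin n) : MvPowerSeries.constantCoeff (pderiv R i f) = 0 :=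
  MvPowerSeries.one_le_order_iff_constCoeff_eq_zero.mp
    (by exact_mod_cast le_order_pderiv (N := 1) (by exact_mod_cast hf) i)

lemma constantCoeff_mulGrad_eq_zero {R : Type*} [CommRing R] [Algebra ℂ R]
    {f : MvPowerSeries (Fin n) R} (hf : 2 ≤ f.order) (i : Fin n) :
    MvPowerSeries.constantCoeff (mulGrad A f i) = 0 := by
  rw [mulGrad, map_sum]
  refine Finset.sum_eq_zero fun j _ => ?_
  rw [Algebra.smul_def, map_mul, constantCoeff_pderiv_eq_zero hf, mul_zero]

lemma constantCoeff_gradMap_hj (hord : 2 ≤ P.order) (i : Fin n) :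
    MvPowerSeries.constantCoeff (gradMap A (hj A P) i) = 0 := by
  rw [gradMap, map_add, MvPowerSeries.constantCoeff_X, zero_add, MvPowerSeries.smul_eq_C_mul,
    map_mul, constantCoeff_mulGrad_eq_zero (two_le_order_hj hord), mul_zero]

/-- `∇Q = ∇P (z + t A ∇Q)`: both sides solve the transport equation with initial value `∇P`. -/
lemma pderiv_hj_eq_subst (hA : A.IsSymm) (hord : 2 ≤ P.order) (i : Fin n) :
    pderiv ℂ⟦X⟧ i (hj A P) = subst (gradMap A (hj A P)) (pderiv ℂ i P) := by
  refine eq_of_transport_eq_zero A (transport_pderiv_hj hA i)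
    (derivation_subst_eq_zero _ (le_order_transport A _) (constantCoeff_gradMap_hj hord)
      (transport_gradMap_hj hA) _) ?_
  rw [atZero_pderiv, atZero_hj, atZero_subst
    (MvPowerSeries.hasSubst_of_constantCoeff_zero (constantCoeff_gradMap_hj hord))]
  intro j
  ext α
  rw [coeff_atZero, gradMap, map_add, map_smul, MvPowerSeries.coeff_X, MvPowerSeries.coeff_X]
  split_ifs <;> simp

/-- The map `z - t A ∇P` over `ℂ⟦t⟧`. -/
def invMap (A : Matrix (Fin n) (Fin n) ℂ) (P : MvPowerSeries (Fin n) ℂ) (i : Fin n) :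
    MvPowerSeries (Fin n) ℂ⟦X⟧ :=
  MvPowerSeries.X i - (PowerSeries.X : ℂ⟦X⟧) •
    mulGrad A (MvPowerSeries.map (algebraMap ℂ ℂ⟦X⟧) P) i

lemma pderiv_map {R S : Type*} [CommRing R] [CommRing S] (h : R →+* S) (i : Fin n)
    (f : MvPowerSeries (Fin n) R) :
    pderiv S i (MvPowerSeries.map h f) = MvPowerSeries.map h (pderiv R i f) := by
  ext α
  simp [coeff_pderiv]

lemma subst_invMap (hA : A.IsSymm) (hord : 2 ≤ P.order) (i : Fin n) :
    subst (gradMap A (hj A P)) (invMap A P i) = MvPowerSeries.X i := by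
  have hs := MvPowerSeries.hasSubst_of_constantCoeff_zero
    (constantCoeff_gradMap_hj (A := A) hord)
  have h : subst (gradMap A (hj A P)) (mulGrad A (MvPowerSeries.map (algebraMap ℂ ℂ⟦X⟧) P) i) =
      mulGrad A (hj A P) i := by
    rw [mulGrad, ← MvPowerSeries.coe_substAlgHom hs, map_sum, mulGrad]
    refine Finset.sum_congr rfl fun j _ => ?_
    rw [MvPowerSeries.coe_substAlgHom hs, MvPowerSeries.subst_smul hs, pderiv_map,
      subst_map_algebraMap hs, pderiv_hj_eq_subst hA hord]
  rw [invMap, MvPowerSeries.subst_sub hs, MvPowerSeries.subst_smul hs, h,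
    MvPowerSeries.subst_X hs, gradMap, add_sub_cancel_right]

lemma constantCoeff_invMap (hord : 2 ≤ P.order) (i : Fin n) :
    MvPowerSeries.constantCoeff (invMap A P i) = 0 := by
  rw [invMap, map_sub, MvPowerSeries.constantCoeff_X, zero_sub, MvPowerSeries.smul_eq_C_mul,
    map_mul, constantCoeff_mulGrad_eq_zero (hord.trans (MvPowerSeries.le_order_map _)), mul_zero,
    neg_zero]

lemma areFormalInverse_invMap (hA : A.IsSymm) (hord : 2 ≤ P.order) :
    AreFormalInverse (invMap A P) (gradMap A (hj A P)) := by
  refine ⟨constantCoeff_invMap hord, constantCoeff_gradMap_hj hord, subst_invMap hA hord,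
    subst_eq_X_of_right_inverse (g := fun i =>
      -mulGrad A (MvPowerSeries.map (algebraMap ℂ ℂ⟦X⟧) P) i) (constantCoeff_invMap hord)
      (constantCoeff_gradMap_hj hord) (fun i => ?_) (subst_invMap hA hord)⟩
  rw [invMap, smul_neg, sub_eq_add_neg]

end Inverse

/-! ### Jacobi's formula -/

section Jacobi

lemma derivation_prod {R S ι : Type*} [CommRing R] [CommRing S] [Algebra R S] [DecidableEq ι]
    (D : Derivation R S S) (s : Finset ι) (f : ι → S) :
    D (∏ i ∈ s, f i) = ∑ i ∈ s, ∏ j ∈ s, if j = i then D (f j) else f j := by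
  induction s using Finset.induction_on with
  | empty => simp
  | insert a s ha ih =>
    rw [Finset.prod_insert ha, Derivation.leibniz, ih, Finset.sum_insert ha,
      Finset.prod_insert ha, if_pos rfl, add_comm, smul_eq_mul, smul_eq_mul, mul_comm (D (f a)),
      Finset.mul_sum]
    congr 1
    · rw [mul_comm, mul_comm (D (f a))]
      congr 1
      exact Finset.prod_congr rfl fun j hj => by rw [if_neg (ne_of_mem_of_not_mem hj ha)]
    · refine Finset.sum_congr rfl fun i hi => ?_
      rw [Finset.prod_insert ha, if_neg (ne_of_mem_of_not_mem hi ha).symm]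

/-- Jacobi's formula for the derivative of a determinant. -/
lemma derivation_det {R S ι : Type*} [CommRing R] [CommRing S] [Algebra R S] [DecidableEq ι]
    [Fintype ι] (D : Derivation R S S) (M : Matrix ι ι S) :
    D M.det = (M.adjugate * M.map D).trace := by
  have h1 : ∀ i, (M.adjugate * M.map D) i i = (M.updateCol i fun k => D (M k i)).det := fun i => by
    rw [← Matrix.cramer_apply, Matrix.cramer_eq_adjugate_mulVec]
    rfl
  simp only [Matrix.trace, Matrix.diag_apply, h1, Matrix.det_apply', map_sum]
  rw [Finset.sum_comm]
  refine Finset.sum_congr rfl fun σ _ => ?_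
  rw [Derivation.leibniz, Derivation.map_intCast, smul_zero, add_zero, derivation_prod,
    smul_eq_mul, Finset.mul_sum]
  refine Finset.sum_congr rfl fun i _ => ?_
  congr 1
  refine Finset.prod_congr rfl fun j _ => ?_
  rw [Matrix.updateCol_apply]
  split_ifs with h
  · rw [h]
  · rfl

end Jacobi

/-! ### Coefficients of substituted power series -/

section CoeffsBelow

variable {n : ℕ} {S : Type*} [CommRing S]

/-- The power series whose coefficients in degrees below `d` lie in the subring `B`. -/
def coeffsBelow (n : ℕ) (B : Subring S) (d : ℕ) : Subring (MvPowerSeries (Fin n) S) where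
  carrier := {f | ∀ α, Finsupp.degree α < d → coeff α f ∈ B}
  mul_mem' := fun {f g} hf hg α hα => by
    classical
    rw [coeff_mul]
    refine B.sum_mem fun p hp => ?_
    have h := congrArg Finsupp.degree (Finset.HasAntidiagonal.mem_antidiagonal.mp hp)
    rw [map_add] at h
    exact B.mul_mem (hf _ (by omega)) (hg _ (by omega))
  one_mem' := fun α _ => by
    classical
    rw [MvPowerSeries.coeff_one]
    split_ifs
    exacts [B.one_mem, B.zero_mem]
  add_mem' := fun {f g} hf hg α hα => by
    rw [map_add]; exact B.add_mem (hf α hα) (hg α hα)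
  zero_mem' := fun α _ => by rw [map_zero]; exact B.zero_mem
  neg_mem' := fun {f} hf α hα => by rw [map_neg]; exact B.neg_mem (hf α hα)

/-- A degree-`d` coefficient of a product of two series without constant terms involves only
coefficients of lower degree. -/
lemma mul_mem_coeffsBelow_succ {B : Subring S} {d : ℕ} {f g : MvPowerSeries (Fin n) S}
    (hf : f ∈ coeffsBelow n B d) (hg : g ∈ coeffsBelow n B d)
    (hf0 : MvPowerSeries.constantCoeff f = 0) (hg0 : MvPowerSeries.constantCoeff g = 0) :
    f * g ∈ coeffsBelow n B (d + 1) := by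
  classical
  intro α hα
  rw [coeff_mul]
  refine B.sum_mem fun p hp => ?_
  have h := congrArg Finsupp.degree (Finset.HasAntidiagonal.mem_antidiagonal.mp hp)
  rw [map_add] at h
  by_cases h1 : p.1 = 0
  · rw [h1, MvPowerSeries.coeff_zero_eq_constantCoeff_apply, hf0, zero_mul]
    exact B.zero_mem
  by_cases h2 : p.2 = 0
  · rw [h2, MvPowerSeries.coeff_zero_eq_constantCoeff_apply, hg0, mul_zero]
    exact B.zero_mem
  have h1' := (Finsupp.degree_eq_zero_iff p.1).not.mpr h1
  have h2' := (Finsupp.degree_eq_zero_iff p.2).not.mpr h2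
  exact B.mul_mem (hf _ (by omega)) (hg _ (by omega))

lemma prod_pow_mem_coeffsBelow_succ {B : Subring S} {d : ℕ} {G : Fin n → MvPowerSeries (Fin n) S}
    (hG : ∀ i, MvPowerSeries.constantCoeff (G i) = 0) (hB : ∀ i, G i ∈ coeffsBelow n B d)
    {β : Fin n →₀ ℕ} (hβ : 2 ≤ Finsupp.degree β) :
    (β.prod fun i e => G i ^ e) ∈ coeffsBelow n B (d + 1) := by
  classical
  have hβ0 : β ≠ 0 := by rintro rfl; simp at hβ
  obtain ⟨i, hi⟩ := Finsupp.ne_iff.mp hβ0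
  rw [Finsupp.zero_apply] at hi
  obtain ⟨γ, rfl⟩ : ∃ γ, β = Finsupp.single i 1 + γ :=
    ⟨β - Finsupp.single i 1, (add_tsub_cancel_of_le
      (Finsupp.single_le_iff.mpr (Nat.one_le_iff_ne_zero.mpr hi))).symm⟩
  rw [map_add, Finsupp.degree_single] at hβ
  have hγ0 : γ ≠ 0 := by rintro rfl; simp at hβ
  obtain ⟨j, hj⟩ := Finsupp.ne_iff.mp hγ0
  rw [Finsupp.zero_apply] at hj
  rw [Finsupp.prod_add_index' (fun _ => pow_zero _) (fun _ _ _ => pow_add _ _ _),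
    Finsupp.prod_single_index (h := fun i e => G i ^ e) (pow_zero _), pow_one]
  refine mul_mem_coeffsBelow_succ (hB i) (Subring.prod_mem _ fun k _ => Subring.pow_mem _ (hB k) _)
    (hG i) ?_
  rw [Finsupp.prod, map_prod]
  exact Finset.prod_eq_zero (Finsupp.mem_support_iff.mpr hj) (by rw [map_pow, hG, zero_pow hj])

/-- If `f` has no terms of degree below two, the degree-`d` coefficients of `f(G)` involve only
coefficients of `G` of lower degree. -/
lemma subst_mem_coeffsBelow_succ {R : Type*} [CommRing R] [Algebra R S] {B : Subring S}
    (hRB : ∀ r : R, algebraMap R S r ∈ B) {d : ℕ} {G : Fin n → MvPowerSeries (Fin n) S}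
    (hG : ∀ i, MvPowerSeries.constantCoeff (G i) = 0) (hB : ∀ i, G i ∈ coeffsBelow n B d)
    {f : MvPowerSeries (Fin n) R} (hf : 2 ≤ f.order) : subst G f ∈ coeffsBelow n B (d + 1) := by
  intro α hα
  rw [MvPowerSeries.coeff_subst (MvPowerSeries.hasSubst_of_constantCoeff_zero hG)]
  refine finsum_induction (· ∈ B) B.zero_mem (fun _ _ => B.add_mem) fun β => ?_
  rcases lt_or_ge (Finsupp.degree β) 2 with h | h
  · rw [MvPowerSeries.coeff_of_lt_order (lt_of_lt_of_le (by exact_mod_cast h) hf), zero_smul]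
    exact B.zero_mem
  · rw [Algebra.smul_def]
    exact B.mul_mem (hRB _) (prod_pow_mem_coeffsBelow_succ hG hB h α hα)

/-- `f` minus its linear part. -/
def higherPart {R : Type*} [CommRing R] (f : MvPowerSeries (Fin n) R) : MvPowerSeries (Fin n) R :=
  f - ∑ k, coeff (Finsupp.single k 1) f • MvPowerSeries.X k

lemma two_le_order_higherPart {R : Type*} [CommRing R] {f : MvPowerSeries (Fin n) R}
    (hf : MvPowerSeries.constantCoeff f = 0) : 2 ≤ (higherPart f).order := by
  classical
  refine MvPowerSeries.nat_le_order (n := 2) fun d hd => ?_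
  simp only [higherPart, map_sub, map_sum, map_smul, MvPowerSeries.coeff_X, smul_eq_mul]
  by_cases h0 : d = 0
  · subst h0
    rw [MvPowerSeries.coeff_zero_eq_constantCoeff_apply, hf, zero_sub, neg_eq_zero]
    refine Finset.sum_eq_zero fun k _ => ?_
    rw [if_neg (by simp [eq_comm]), mul_zero]
  · have h1 : Finsupp.degree d = 1 := by
      have := (Finsupp.degree_eq_zero_iff d).not.mpr h0
      omega
    obtain ⟨k, rfl⟩ : ∃ k, d = Finsupp.single k 1 := by
      obtain ⟨k, hk⟩ := Finsupp.ne_iff.mp h0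
      rw [Finsupp.zero_apply] at hk
      have hd := add_tsub_cancel_of_le (Finsupp.single_le_iff.mpr (Nat.one_le_iff_ne_zero.mpr hk))
      refine ⟨k, ?_⟩
      have h2 := congrArg Finsupp.degree hd
      rw [map_add, Finsupp.degree_single, h1] at h2
      have h3 := (Finsupp.degree_eq_zero_iff (d - Finsupp.single k 1)).mp (by omega)
      rw [h3, add_zero] at hd
      exact hd.symm
    simp [Finsupp.single_left_inj]

lemma subst_eq_linear_add_higherPart {R : Type*} [CommRing R] [Algebra R S]
    {G : Fin n → MvPowerSeries (Fin n) S} (hs : MvPowerSeries.HasSubst G)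
    (f : MvPowerSeries (Fin n) R) :
    subst G f = (∑ k, coeff (Finsupp.single k 1) f • G k) + subst G (higherPart f) := by
  have h : f = (∑ k, coeff (Finsupp.single k 1) f • MvPowerSeries.X k) + higherPart f := by
    rw [higherPart]; ring
  conv_lhs => rw [h]
  rw [MvPowerSeries.subst_add hs]
  congr 1
  rw [← MvPowerSeries.coe_substAlgHom hs, map_sum]
  refine Finset.sum_congr rfl fun k _ => ?_
  rw [map_smul, MvPowerSeries.substAlgHom_X]

lemma two_le_order_subst_higherPart {R : Type*} [CommRing R] [Algebra R S]
    {G : Fin n → MvPowerSeries (Fin n) S} (hG : ∀ i, MvPowerSeries.constantCoeff (G i) = 0)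
    {f : MvPowerSeries (Fin n) R} (hf : MvPowerSeries.constantCoeff f = 0) :
    2 ≤ (subst G (higherPart f)).order := by
  refine le_trans ?_ (MvPowerSeries.le_order_subst
    (MvPowerSeries.hasSubst_of_constantCoeff_zero hG) _)
  have h1 : (1 : ℕ∞) ≤ ⨅ i, (G i).order :=
    le_iInf fun i => MvPowerSeries.one_le_order_iff_constCoeff_eq_zero.mpr (hG i)
  calc (2 : ℕ∞) ≤ (higherPart f).order := two_le_order_higherPart hf
    _ = 1 * (higherPart f).order := (one_mul _).symm
    _ ≤ _ := by gcongr

end CoeffsBelow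

/-! ### Polynomial dependence on `t` -/

section Polynomiality

variable {n : ℕ}

/-- The subring `ℂ[t]` of `ℂ⟦t⟧`. -/
def polySubring : Subring ℂ⟦X⟧ := (Polynomial.coeToPowerSeries.ringHom : ℂ[X] →+* ℂ⟦X⟧).range

lemma coe_mem_polySubring (p : ℂ[X]) : (p : ℂ⟦X⟧) ∈ polySubring := ⟨p, rfl⟩

lemma X_mem_polySubring : (PowerSeries.X : ℂ⟦X⟧) ∈ polySubring := by
  rw [← Polynomial.coe_X]; exact coe_mem_polySubring _

lemma algebraMap_mem_polySubring (c : ℂ) : algebraMap ℂ ℂ⟦X⟧ c ∈ polySubring := by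
  rw [show algebraMap ℂ ℂ⟦X⟧ c = ((Polynomial.C c : ℂ[X]) : ℂ⟦X⟧) by
    rw [Polynomial.coe_C]; rfl]
  exact coe_mem_polySubring _

lemma smul_mem_coeffsBelow {S : Type*} [CommRing S] {B : Subring S} {d : ℕ} {r : S}
    {f : MvPowerSeries (Fin n) S} (hr : r ∈ B) (hf : f ∈ coeffsBelow n B d) :
    r • f ∈ coeffsBelow n B d := fun α hα => by
  rw [MvPowerSeries.coeff_smul]; exact B.mul_mem hr (hf α hα)

lemma complex_smul_mem_coeffsBelow {d : ℕ} (c : ℂ) {f : MvPowerSeries (Fin n) ℂ⟦X⟧}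
    (hf : f ∈ coeffsBelow n polySubring d) : c • f ∈ coeffsBelow n polySubring d := by
  rw [← algebraMap_smul ℂ⟦X⟧ c f]
  exact smul_mem_coeffsBelow (algebraMap_mem_polySubring c) hf

lemma coeff_single_eq_constantCoeff_pderiv {R : Type*} [CommRing R] (i : Fin n)
    (f : MvPowerSeries (Fin n) R) :
    coeff (Finsupp.single i 1) f = MvPowerSeries.constantCoeff (pderiv R i f) := by
  rw [← MvPowerSeries.coeff_zero_eq_constantCoeff_apply, coeff_pderiv]
  simp

variable (A : Matrix (Fin n) (Fin n) ℂ) (P : MvPowerSeries (Fin n) ℂ)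

/-- The matrix `(Hess P)(0) A` over `ℂ[t]`, multiplied by `t`. -/
def hessMatrix : Matrix (Fin n) (Fin n) ℂ[X] := Matrix.of fun m k =>
  Polynomial.X * Polynomial.C (∑ l, A k l * coeff (Finsupp.single m 1) (pderiv ℂ l P))

/-- The Jacobian matrix at `z = 0` of `z + t A ∇Q`, where `Q` is the Hamilton–Jacobi solution. -/
def jac : Matrix (Fin n) (Fin n) ℂ⟦X⟧ := Matrix.of fun i k =>
  coeff (Finsupp.single i 1) (gradMap A (hj A P) k)

/-- The image of `hessMatrix` over `ℂ⟦t⟧`. -/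
def hessMatrixSeries : Matrix (Fin n) (Fin n) ℂ⟦X⟧ :=
  (Polynomial.coeToPowerSeries.ringHom : ℂ[X] →+* ℂ⟦X⟧).mapMatrix (hessMatrix A P)

lemma hessMatrixSeries_apply (m k : Fin n) : hessMatrixSeries A P m k =
    PowerSeries.X *
      algebraMap ℂ ℂ⟦X⟧ (∑ l, A k l * coeff (Finsupp.single m 1) (pderiv ℂ l P)) := by
  simp only [hessMatrixSeries, hessMatrix, RingHom.mapMatrix_apply, Matrix.map_apply,
    Matrix.of_apply, map_mul]
  congr 1
  · exact Polynomial.coe_X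
  · exact Polynomial.coe_C _

/-- The contribution of the terms of degree at least two of `∇P` to `t A ∇P(z + t A ∇Q)`. -/
def higherRem (k : Fin n) : MvPowerSeries (Fin n) ℂ⟦X⟧ :=
  (PowerSeries.X : ℂ⟦X⟧) • ∑ l, A k l • subst (gradMap A (hj A P)) (higherPart (pderiv ℂ l P))

variable {A P}

lemma gradMap_hj_eq (hA : A.IsSymm) (hord : 2 ≤ P.order) (k : Fin n) :
    gradMap A (hj A P) k = MvPowerSeries.X k +
      (∑ m, hessMatrixSeries A P m k • gradMap A (hj A P) m) + higherRem A P k := by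
  have hs := MvPowerSeries.hasSubst_of_constantCoeff_zero
    (constantCoeff_gradMap_hj (A := A) hord)
  have hV : ∀ l, pderiv ℂ⟦X⟧ l (hj A P) =
      (∑ m, coeff (Finsupp.single m 1) (pderiv ℂ l P) • gradMap A (hj A P) m) +
        subst (gradMap A (hj A P)) (higherPart (pderiv ℂ l P)) := fun l => by
    rw [pderiv_hj_eq_subst hA hord, ← subst_eq_linear_add_higherPart hs]
  conv_lhs => rw [gradMap, mulGrad]
  simp only [hV]
  rw [higherRem, add_assoc]
  congr 1
  simp only [smul_add, Finset.sum_add_distrib]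
  congr 1
  simp only [Finset.smul_sum]
  rw [Finset.sum_comm]
  refine Finset.sum_congr rfl fun m _ => ?_
  rw [hessMatrixSeries_apply, mul_smul, algebraMap_smul, Finset.sum_smul, Finset.smul_sum]
  exact Finset.sum_congr rfl fun l _ => by rw [smul_smul (A k l)]

lemma coeff_single_higherRem (hord : 2 ≤ P.order) (i k : Fin n) :
    coeff (Finsupp.single i 1) (higherRem A P k) = 0 := by
  rw [higherRem, map_smul, map_sum, Finset.sum_eq_zero, smul_zero]
  intro l _
  change A k l • coeff (Finsupp.single i 1)
    (subst (gradMap A (hj A P)) (higherPart (pderiv ℂ l P))) = 0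
  rw [MvPowerSeries.coeff_of_lt_order, smul_zero]
  refine lt_of_lt_of_le ?_ (two_le_order_subst_higherPart (constantCoeff_gradMap_hj hord)
    (constantCoeff_pderiv_eq_zero hord l))
  rw [Finsupp.degree_single]
  exact_mod_cast one_lt_two

lemma jac_mul (hA : A.IsSymm) (hord : 2 ≤ P.order) :
    jac A P * (1 - hessMatrixSeries A P) = 1 := by
  classical
  have h : jac A P = 1 + jac A P * hessMatrixSeries A P := by
    ext1 i k
    rw [Matrix.add_apply, Matrix.mul_apply]
    simp only [jac, Matrix.of_apply]
    conv_lhs => rw [gradMap_hj_eq hA hord k]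
    rw [map_add, map_add, coeff_single_higherRem hord, add_zero, map_sum, MvPowerSeries.coeff_X,
      Matrix.one_apply]
    congr 1
    · simp [Finsupp.single_left_inj]
    · exact Finset.sum_congr rfl fun m _ => by
        rw [MvPowerSeries.coeff_smul, mul_comm]
  rw [mul_sub, mul_one, sub_eq_iff_eq_add]
  exact h

/-- `Δ_A Q` is, up to the factor `t`, the trace of the Jacobian of `z + t A ∇Q` minus `n`. -/
lemma trace_jac (hP : IsLapNilpotent A P) : (jac A P).trace = n := by
  have h0 : ∑ i, ∑ j, A i j • MvPowerSeries.constantCoeff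
      (pderiv ℂ⟦X⟧ i (pderiv ℂ⟦X⟧ j (hj A P))) = 0 := by
    have h := congrArg (MvPowerSeries.constantCoeff) (heat_eq_and_lap_hj_eq_zero hP).2
    rw [lap, map_zero, map_sum] at h
    rw [← h]
    refine Finset.sum_congr rfl fun i _ => ?_
    rw [map_sum]
    rfl
  have h1 : ∀ i, jac A P i i = 1 + PowerSeries.X * ∑ j, A i j • MvPowerSeries.constantCoeff
      (pderiv ℂ⟦X⟧ i (pderiv ℂ⟦X⟧ j (hj A P))) := fun i => by
    classical
    simp only [jac, Matrix.of_apply]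
    rw [gradMap, map_add, MvPowerSeries.coeff_smul, mulGrad, map_sum, MvPowerSeries.coeff_X,
      if_pos rfl]
    simp only [← coeff_single_eq_constantCoeff_pderiv]
    rfl
  simp only [Matrix.trace, Matrix.diag_apply, h1, Finset.sum_add_distrib, ← Finset.mul_sum, h0]
  simp

/-- The determinant of `1 - t (Hess P)(0) A` has derivative zero by Jacobi's formula and
`trace_jac`. -/
lemma det_one_sub_hessMatrixSeries (hA : A.IsSymm) (hord : 2 ≤ P.order)
    (hP : IsLapNilpotent A P) : (1 - hessMatrixSeries A P).det = 1 := by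
  classical
  set T := hessMatrixSeries A P with hT
  set J := jac A P with hJ
  have hJT : J * (1 - T) = 1 := jac_mul hA hord
  have hadj : (1 - T).adjugate = (1 - T).det • J := by
    calc (1 - T).adjugate = J * (1 - T) * (1 - T).adjugate := by rw [hJT, one_mul]
      _ = (1 - T).det • J := by
        rw [mul_assoc, Matrix.mul_adjugate, Matrix.mul_smul, mul_one]
  have htr : (J * T).trace = 0 := by
    have h : J * T = J - 1 := by
      rw [← hJT, mul_sub, mul_one]; abel
    rw [h, Matrix.trace_sub, hJ, trace_jac hP, Matrix.trace_one, Fintype.card_fin, sub_self]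
  have hmap : (PowerSeries.X : ℂ⟦X⟧) • (1 - T).map (PowerSeries.derivative ℂ) = -T := by
    ext1 i k
    rw [Matrix.smul_apply, Matrix.map_apply, Matrix.sub_apply, map_sub, Matrix.neg_apply,
      hT, hessMatrixSeries_apply, Derivation.leibniz, Derivation.map_algebraMap,
      PowerSeries.derivative_X, Matrix.one_apply]
    split_ifs <;> simp
  apply PowerSeries.derivative.ext
  · have h : PowerSeries.X * PowerSeries.derivative ℂ (1 - T).det = 0 := by
      rw [derivation_det, ← smul_eq_mul, ← Matrix.trace_smul, ← Matrix.mul_smul, hmap, hadj,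
        Matrix.mul_neg, Matrix.smul_mul, Matrix.trace_neg, Matrix.trace_smul, htr, smul_zero,
        neg_zero]
    rw [(mul_eq_zero.mp h).resolve_left PowerSeries.X_ne_zero]
    simp
  · rw [RingHom.map_det]
    have h : (PowerSeries.constantCoeff (R := ℂ)).mapMatrix (1 - T) = 1 := by
      rw [map_sub, map_one]
      ext1 i k
      simp [hT, hessMatrixSeries_apply]
    rw [h, Matrix.det_one, map_one]

lemma jac_mem_polySubring (hA : A.IsSymm) (hord : 2 ≤ P.order) (hP : IsLapNilpotent A P)
    (i k : Fin n) : jac A P i k ∈ polySubring := by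
  classical
  have h : jac A P = (1 - hessMatrixSeries A P).adjugate := by
    calc jac A P = jac A P * ((1 - hessMatrixSeries A P) * (1 - hessMatrixSeries A P).adjugate) := by
          rw [Matrix.mul_adjugate, det_one_sub_hessMatrixSeries hA hord hP, one_smul, mul_one]
      _ = _ := by rw [← mul_assoc, jac_mul hA hord, one_mul]
  have h2 : 1 - hessMatrixSeries A P =
      (Polynomial.coeToPowerSeries.ringHom : ℂ[X] →+* ℂ⟦X⟧).mapMatrix (1 - hessMatrix A P) := by
    rw [map_sub, map_one, hessMatrixSeries]
  rw [h, h2, ← RingHom.map_adjugate]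
  exact ⟨_, rfl⟩

lemma gradMap_hj_eq_jac (hA : A.IsSymm) (hord : 2 ≤ P.order) (j : Fin n) :
    gradMap A (hj A P) j =
      ∑ k, jac A P k j • (MvPowerSeries.X k + higherRem A P k) := by
  classical
  have hinv : (1 - hessMatrixSeries A P) * jac A P = 1 := mul_eq_one_comm.mp (jac_mul hA hord)
  have h1 : ∀ k, MvPowerSeries.X k + higherRem A P k =
      ∑ m, (1 - hessMatrixSeries A P) m k • gradMap A (hj A P) m := fun k => by
    have h := gradMap_hj_eq hA hord k
    simp only [Matrix.sub_apply, sub_smul, Finset.sum_sub_distrib, Matrix.one_apply, ite_smul,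
      one_smul, zero_smul, Finset.sum_ite_eq', Finset.mem_univ, if_true]
    rw [eq_sub_iff_add_eq]
    conv_rhs => rw [h]
    ring
  simp only [h1, Finset.smul_sum, smul_smul]
  rw [Finset.sum_comm]
  have h2 : ∀ m, ∑ k, (jac A P k j * (1 - hessMatrixSeries A P) m k) • gradMap A (hj A P) m =
      (1 : Matrix (Fin n) (Fin n) ℂ⟦X⟧) m j • gradMap A (hj A P) m := fun m => by
    have h := congrFun (congrFun hinv m) j
    rw [Matrix.mul_apply] at h
    rw [← Finset.sum_smul, ← h]
    exact congrArg (· • _) (Finset.sum_congr rfl fun k _ => mul_comm _ _)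
  simp only [h2, Matrix.one_apply, ite_smul, one_smul, zero_smul, Finset.sum_ite_eq',
    Finset.mem_univ, if_true]

/-- The inverse map has coefficients in `ℂ[t]`, by induction on the degree in `z`. -/
lemma gradMap_hj_mem_coeffsBelow (hA : A.IsSymm) (hord : 2 ≤ P.order) (hP : IsLapNilpotent A P)
    (d : ℕ) (j : Fin n) : gradMap A (hj A P) j ∈ coeffsBelow n polySubring d := by
  classical
  induction d generalizing j with
  | zero => exact fun α hα => absurd hα (Nat.not_lt_zero _)
  | succ d ih =>
    rw [gradMap_hj_eq_jac hA hord]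
    refine Subring.sum_mem _ fun k _ => smul_mem_coeffsBelow (jac_mem_polySubring hA hord hP k j)
      (Subring.add_mem _ (fun α _ => ?_) (smul_mem_coeffsBelow X_mem_polySubring
        (Subring.sum_mem _ fun l _ => complex_smul_mem_coeffsBelow _ ?_)))
    · rw [MvPowerSeries.coeff_X]
      split_ifs
      exacts [Subring.one_mem _, Subring.zero_mem _]
    · exact subst_mem_coeffsBelow_succ algebraMap_mem_polySubring (constantCoeff_gradMap_hj hord)
        ih (two_le_order_higherPart (constantCoeff_pderiv_eq_zero hord l))

lemma coeff_hj_mem_polySubring (hA : A.IsSymm) (hord : 2 ≤ P.order) (hP : IsLapNilpotent A P)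
    (α : Fin n →₀ ℕ) : coeff α (hj A P) ∈ polySubring := by
  by_cases h0 : α = 0
  · rw [MvPowerSeries.coeff_of_lt_order]
    · exact Subring.zero_mem _
    · rw [h0, map_zero]
      exact lt_of_lt_of_le (by norm_num) (two_le_order_hj hord)
  obtain ⟨i, hi⟩ := Finsupp.ne_iff.mp h0
  rw [Finsupp.zero_apply] at hi
  obtain ⟨γ, rfl⟩ : ∃ γ, α = γ + Finsupp.single i 1 :=
    ⟨α - Finsupp.single i 1, (tsub_add_cancel_of_le
      (Finsupp.single_le_iff.mpr (Nat.one_le_iff_ne_zero.mpr hi))).symm⟩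
  have hs := MvPowerSeries.hasSubst_of_constantCoeff_zero
    (constantCoeff_gradMap_hj (A := A) hord)
  have hmem : pderiv ℂ⟦X⟧ i (hj A P) ∈ coeffsBelow n polySubring (Finsupp.degree γ + 1) := by
    rw [pderiv_hj_eq_subst hA hord, subst_eq_linear_add_higherPart hs]
    exact Subring.add_mem _ (Subring.sum_mem _ fun k _ => complex_smul_mem_coeffsBelow _
      (gradMap_hj_mem_coeffsBelow hA hord hP _ k))
      (subst_mem_coeffsBelow_succ algebraMap_mem_polySubring (constantCoeff_gradMap_hj hord)
        (gradMap_hj_mem_coeffsBelow hA hord hP _)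
        (two_le_order_higherPart (constantCoeff_pderiv_eq_zero hord i)))
  have h := Subring.mul_mem _ (hmem γ (Nat.lt_succ_self _))
    (algebraMap_mem_polySubring ((γ i : ℂ) + 1)⁻¹)
  have hc : ((γ i : ℂ) + 1) ≠ 0 := Nat.cast_add_one_ne_zero _
  have hc' : ((γ i : ℂ⟦X⟧) + 1) = algebraMap ℂ ℂ⟦X⟧ ((γ i : ℂ) + 1) := by simp
  rwa [coeff_pderiv, hc', mul_assoc, ← map_mul, mul_inv_cancel₀ hc, map_one, mul_one] at h

end Polynomiality

/-! ### Descent to `ℂ[t]` and uniqueness -/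

section Descent

variable {n : ℕ} {A : Matrix (Fin n) (Fin n) ℂ} {P : MvPowerSeries (Fin n) ℂ}

lemma exists_toSeries_eq_hj (hA : A.IsSymm) (hord : 2 ≤ P.order) (hP : IsLapNilpotent A P) :
    ∃ Q : MvPowerSeries (Fin n) ℂ[X], toSeries Q = hj A P := by
  choose q hq using coeff_hj_mem_polySubring hA hord hP
  exact ⟨q, MvPowerSeries.ext fun α => hq α⟩

lemma map_mulGrad {R S : Type*} [CommRing R] [CommRing S] [Algebra ℂ R] [Algebra ℂ S]
    (h : R →+* S) (hh : ∀ c : ℂ, h (algebraMap ℂ R c) = algebraMap ℂ S c)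
    (f : MvPowerSeries (Fin n) R) (i : Fin n) :
    MvPowerSeries.map h (mulGrad A f i) = mulGrad A (MvPowerSeries.map h f) i := by
  ext α
  rw [MvPowerSeries.coeff_map, mulGrad, mulGrad, map_sum, map_sum, map_sum]
  refine Finset.sum_congr rfl fun j _ => ?_
  change h (A i j • coeff α (pderiv R j f)) =
    A i j • coeff α (pderiv S j (MvPowerSeries.map h f))
  rw [pderiv_map, MvPowerSeries.coeff_map, Algebra.smul_def, Algebra.smul_def, map_mul, hh]

lemma map_injective {R S : Type*} [CommRing R] [CommRing S] {h : R →+* S}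
    (hh : Function.Injective h) :
    Function.Injective (MvPowerSeries.map h : MvPowerSeries (Fin n) R →+* _) := fun f g hfg => by
  ext α
  have := congrArg (coeff α) hfg
  rw [MvPowerSeries.coeff_map, MvPowerSeries.coeff_map] at this
  exact hh this

lemma AreFormalInverse.of_map {R S : Type*} [CommRing R] [CommRing S] {h : R →+* S}
    (hh : Function.Injective h) {F G : Fin n → MvPowerSeries (Fin n) R}
    (H : AreFormalInverse (fun i => MvPowerSeries.map h (F i))
      (fun i => MvPowerSeries.map h (G i))) : AreFormalInverse F G := by
  obtain ⟨hF, hG, hFG, hGF⟩ := H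
  have h0 : ∀ f : MvPowerSeries (Fin n) R,
      MvPowerSeries.constantCoeff (MvPowerSeries.map h f) = 0 →
      MvPowerSeries.constantCoeff f = 0 := fun f hf => by
    rw [MvPowerSeries.constantCoeff_map] at hf
    exact hh (hf.trans (map_zero h).symm)
  have hF' : ∀ i, MvPowerSeries.constantCoeff (F i) = 0 := fun i => h0 _ (hF i)
  have hG' : ∀ i, MvPowerSeries.constantCoeff (G i) = 0 := fun i => h0 _ (hG i)
  refine ⟨hF', hG', fun i => map_injective hh ?_, fun i => map_injective hh ?_⟩
  · rw [MvPowerSeries.map_subst (MvPowerSeries.hasSubst_of_constantCoeff_zero hG'), hFG,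
      MvPowerSeries.map_X]
  · rw [MvPowerSeries.map_subst (MvPowerSeries.hasSubst_of_constantCoeff_zero hF'), hGF,
      MvPowerSeries.map_X]

lemma AreFormalInverse.unique {R : Type*} [CommRing R] {F G G' : Fin n → MvPowerSeries (Fin n) R}
    (h : AreFormalInverse F G) (h' : AreFormalInverse F G') : G' = G := by
  obtain ⟨hF, hG, hFG, -⟩ := h
  have hsF := MvPowerSeries.hasSubst_of_constantCoeff_zero hF
  have hsG := MvPowerSeries.hasSubst_of_constantCoeff_zero hG
  funext i
  have h1 := congrArg (subst G) (h'.2.2.2 i)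
  rw [MvPowerSeries.subst_comp_subst_apply hsF hsG, MvPowerSeries.subst_X hsG, funext hFG,
    MvPowerSeries.subst_self] at h1
  exact h1

lemma coeToPowerSeries_injective :
    Function.Injective (Polynomial.coeToPowerSeries.ringHom : ℂ[X] →+* ℂ⟦X⟧) :=
  Polynomial.coe_injective ℂ

lemma coeToPowerSeries_algebraMap (c : ℂ) :
    (Polynomial.coeToPowerSeries.ringHom : ℂ[X] →+* ℂ⟦X⟧) (algebraMap ℂ ℂ[X] c) =
      algebraMap ℂ ℂ⟦X⟧ c := Polynomial.coe_C c

lemma map_X_smul (f : MvPowerSeries (Fin n) ℂ[X]) :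
    MvPowerSeries.map (Polynomial.coeToPowerSeries.ringHom : ℂ[X] →+* ℂ⟦X⟧)
      ((Polynomial.X : ℂ[X]) • f) = (PowerSeries.X : ℂ⟦X⟧) •
      MvPowerSeries.map (Polynomial.coeToPowerSeries.ringHom : ℂ[X] →+* ℂ⟦X⟧) f := by
  ext1 α
  rw [MvPowerSeries.coeff_map, MvPowerSeries.coeff_smul, MvPowerSeries.coeff_smul, map_mul,
    MvPowerSeries.coeff_map]
  congr 1
  exact Polynomial.coe_X

lemma isInversionPotential_of_toSeries_eq_hj (hA : A.IsSymm) (hord : 2 ≤ P.order)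
    {Q : MvPowerSeries (Fin n) ℂ[X]} (hQ : toSeries Q = hj A P) : IsInversionPotential A P Q := by
  constructor
  · have h : MvPowerSeries.constantCoeff (toSeries Q) = 0 := by
      rw [hQ]
      exact MvPowerSeries.one_le_order_iff_constCoeff_eq_zero.mp
        (le_trans (by norm_num) (two_le_order_hj hord))
    rw [toSeries, MvPowerSeries.constantCoeff_map] at h
    exact coeToPowerSeries_injective (h.trans (map_zero _).symm)
  · refine AreFormalInverse.of_map coeToPowerSeries_injective ?_
    have h1 : (fun i => MvPowerSeries.map Polynomial.coeToPowerSeries.ringHom (mapF A P i)) =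
        invMap A P := funext fun i => by
      rw [mapF, map_sub, map_X_smul, map_mulGrad _ coeToPowerSeries_algebraMap,
        MvPowerSeries.map_X, invMap]
      congr 3
      ext1 α
      simp only [MvPowerSeries.coeff_map, coeToPowerSeries_algebraMap]
    have h2 : (fun i => MvPowerSeries.map Polynomial.coeToPowerSeries.ringHom (mapG A Q i)) =
        gradMap A (hj A P) := funext fun i => by
      rw [mapG, map_add, map_X_smul, map_mulGrad _ coeToPowerSeries_algebraMap,
        MvPowerSeries.map_X, gradMap, ← hQ, toSeries]
    rw [h1, h2]
    exact areFormalInverse_invMap hA hord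

lemma pderiv_eq_of_mulGrad_eq {R : Type*} [CommRing R] [Algebra ℂ R] (hdet : IsUnit A.det)
    {f g : MvPowerSeries (Fin n) R} (h : ∀ i, mulGrad A f i = mulGrad A g i) (k : Fin n) :
    pderiv R k f = pderiv R k g := by
  classical
  have key : ∀ f : MvPowerSeries (Fin n) R, ∑ i, A⁻¹ k i • mulGrad A f i = pderiv R k f :=
    fun f => by
      simp only [mulGrad, Finset.smul_sum, smul_smul]
      rw [Finset.sum_comm]
      simp only [← Finset.sum_smul, ← Matrix.mul_apply, Matrix.nonsing_inv_mul A hdet,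
        Matrix.one_apply, ite_smul, one_smul, zero_smul, Finset.sum_ite_eq, Finset.mem_univ,
        if_true]
  rw [← key f, ← key g]
  simp only [h]

lemma IsInversionPotential.unique (hdet : IsUnit A.det) {Q Q' : MvPowerSeries (Fin n) ℂ[X]}
    (h : IsInversionPotential A P Q) (h' : IsInversionPotential A P Q') : Q' = Q := by
  refine MvPowerSeries.pderiv.ext (pderiv_eq_of_mulGrad_eq hdet fun i => ?_) (h'.1.trans h.1.symm)
  have h1 : (Polynomial.X : ℂ[X]) • mulGrad A Q' i = (Polynomial.X : ℂ[X]) • mulGrad A Q i :=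
    add_left_cancel (congrFun (h.2.unique h'.2) i)
  ext1 α
  have h2 := congrArg (coeff α) h1
  rw [MvPowerSeries.coeff_smul, MvPowerSeries.coeff_smul] at h2
  exact mul_left_cancel₀ Polynomial.X_ne_zero h2

end Descent

end LaplaceInversion

end

theorem theorem3p2 (n : ℕ) (A : Matrix (Fin n) (Fin n) ℂ) (hA : A.IsSymm) (hdet : IsUnit A.det)
    (P : MvPowerSeries (Fin n) ℂ) (hord : 2 ≤ P.order)
    (hP : LaplaceInversion.IsLapNilpotent A P) :
    ∃ Q : MvPowerSeries (Fin n) ℂ[X],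
      (LaplaceInversion.IsInversionPotential A P Q ∧
        ∀ Q' : MvPowerSeries (Fin n) ℂ[X],
          LaplaceInversion.IsInversionPotential A P Q' → Q' = Q) ∧
      (LaplaceInversion.SolvesCauchy A P (LaplaceInversion.toSeries Q) ∧
        ∀ Q' : MvPowerSeries (Fin n) ℂ⟦X⟧,
          LaplaceInversion.SolvesCauchy A P Q' → Q' = LaplaceInversion.toSeries Q) ∧
      ∀ k : ℕ, 1 ≤ k →
        LaplaceInversion.toSeries Q ^ k =
          LaplaceInversion.tSeries fun m =>
            ((k ! : ℂ) / (2 ^ m * (m ! : ℂ) * ((m + k)! : ℂ))) •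
              (LaplaceInversion.lap A)^[m] (P ^ (m + k)) := by
  obtain ⟨Q, hQ⟩ := LaplaceInversion.exists_toSeries_eq_hj hA hord hP
  have hpot := LaplaceInversion.isInversionPotential_of_toSeries_eq_hj hA hord hQ
  refine ⟨Q, ⟨hpot, fun Q' h => hpot.unique hdet h⟩, ?_, fun k _ => ?_⟩
  · rw [hQ]
    have h := LaplaceInversion.solvesCauchy_hj hP
    exact ⟨h, fun Q' h' => h.unique h'⟩
  · rw [hQ, LaplaceInversion.hj_pow hP]
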